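/- **Conventions.** A \emph{graph} $\Gamma$ consists of a set $V(\Gamma)$ of vertices, a set $\overrightarrow{E}(\Gamma)$ of directed edges, a fixed point free involution $e\mapsto e^{-1}$ of $\overrightarrow{E}(\Gamma)$ and a terminus map $\tau:\overrightarrow{E}(\Gamma)\to V(\Gamma)$; thus loops and parallel edges are allowed. Its set of undirected edges is $E(\Gamma)=\overrightarrow{E}(\Gamma)/{}^{-1}$, and the degree of a vertex $v$ is $|\tau^{-1}(v)|$. An isomorphism is a pair of bijections, on vertices and on directed edges, commuting with ${}^{-1}$ and $\tau$. A graph is connected if it is non-empty and any two of its vertices are joined by a walk. A cycle has length $n$ with $1\le n\le\infty$: a cycle of length $1$ is a loop, one of length $2$ is a pair of parallel edges, and one of length $\infty$ is a two-way infinite path. A \emph{weak multicycle} is a graph that is a vertex-disjoint union of cycles and single edges (an edge with two distinct endvertices). A \emph{weak multicycle colouring} of $\Gamma$ is a map $c:E(\Gamma)\to\Omega$ to some set such that for every $\omega\in\Omega$ the graph with vertex set $V(\Gamma)$ and edge set $c^{-1}(\omega)$ is a weak multicycle; it is \emph{partition-friendly} if each of these graphs is regular (so each is either a spanning disjoint union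 of cycles or a perfect matching). A \emph{partite presentation} $P=\langle X\mid\mathcal U\mid\mathcal I\mid\phi\mid\mathcal R\rangle$ consists of a non-empty set $X$; disjoint sets $\mathcal U,\mathcal I$ with union $\mathcal S$, which define the group $MF_P=\langle\mathcal S\mid s^2\ (s\in\mathcal I)\rangle$; a map $\phi:\mathcal S\to\mathrm{Sym}(X)$ such that $\phi(s)$ is a fixed point free involution for each $s\in\mathcal I$ and such that the induced right action $x\cdot s_1\cdots s_n=\phi(s_n)\circ\cdots\circ\phi(s_1)(x)$ of $MF_P$ on $X$ (with $\phi(s^{-1})=\phi(s)^{-1}$) is transitive; and, for each $x\in X$, a set $\mathcal R_x\subseteq MF_P$ of elements fixing $x$. Let $T_P$ be the tree with vertex set $MF_P$ that has, for each $w\in MF_P$ and $s\in\mathcal S\cup\mathcal S^{-1}$ (where $s^{-1}=s$ for $s\in\mathcal I$), a directed edge of colour $s$ from $w$ to $ws$, whose inverse is the edge of colour $s^{-1}$ from $ws$ to $w$. For $x\in X$ let $R_x$ be the subgroup of $MF_P$ generated by all $wrw^{-1}$ with $w\in MF_P$ and $r\in\mathcal R_{x\cdot w}$. Fix $b\in X$.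 Call vertices $g,h$ of $T_P$ equivalent if $b\cdot g=b\cdot h=:x$ and $g^{-1}h\in R_x$, and call two directed edges equivalent if they have the same colour, equivalent initial vertices and equivalent terminal vertices. The \emph{partite Cayley graph} $\mathrm{Sp}(P)$ is the quotient of $T_P$ by these relations; up to isomorphism it does not depend on $b$. **Theorem.** A connected graph $\Gamma$ has a partition-friendly weak multicycle colouring if and only if $\Gamma$ is isomorphic to $\mathrm{Sp}(P)$ for some partite presentation $P$. -/

import Mathlib

universe u v

/-- A graph in the sense of Gersten and Serre: vertices, directed edges, a fixed point free
involution on the directed edges, and a terminus map. Loops and parallel edges are allowed. -/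
structure SerreGraph where
  V : Type u
  E : Type u
  inv : E → E
  inv_inv : ∀ e, inv (inv e) = e
  inv_ne : ∀ e, inv e ≠ e
  tau : E → V

namespace SerreGraph

/-- Isomorphisms: bijections on vertices and on directed edges that commute with the involution
and the terminus map. -/
structure Iso (G : SerreGraph.{u}) (H : SerreGraph.{v}) where
  onV : G.V ≃ H.V
  onE : G.E ≃ H.E
  map_inv : ∀ e, onE (G.inv e) = H.inv (onE e)
  map_tau : ∀ e, onV (G.tau e) = H.tau (onE e)

/-- The degree of a vertex: the cardinality of `tau ⁻¹ {x}` (so a loop counts twice). -/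
def degree (G : SerreGraph.{u}) (x : G.V) : Cardinal.{u} :=
  Cardinal.mk {e : G.E // G.tau e = x}

def IsRegular (G : SerreGraph.{u}) : Prop :=
  ∃ k : Cardinal.{u}, ∀ x, G.degree x = k

/-- There is a directed edge from `x` to `y`. -/
def Step (G : SerreGraph.{u}) (x y : G.V) : Prop :=
  ∃ e : G.E, G.tau (G.inv e) = x ∧ G.tau e = y

/-- Nonempty, and any two vertices are joined by a walk. -/
def Connected (G : SerreGraph.{u}) : Prop :=
  Nonempty G.V ∧ ∀ x y : G.V, Relation.ReflTransGen G.Step x y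

/-- The undirected edges: directed edges modulo the involution. -/
def UEdge (G : SerreGraph.{u}) : Type u :=
  Quot fun e f : G.E => f = G.inv e

/-- The undirected edge underlying a directed edge. -/
def toUEdge (G : SerreGraph.{u}) (e : G.E) : G.UEdge :=
  Quot.mk _ e

theorem toUEdge_inv (G : SerreGraph.{u}) (e : G.E) : G.toUEdge (G.inv e) = G.toUEdge e :=
  (Quot.sound (r := fun e f : G.E => f = G.inv e) (a := e) rfl).symm

/-- The disjoint union of a family of graphs. -/
def disjUnion {ι : Type u} (G : ι → SerreGraph.{v}) : SerreGraph.{max u v} where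
  V := Σ i, (G i).V
  E := Σ i, (G i).E
  inv e := ⟨e.1, (G e.1).inv e.2⟩
  inv_inv e := by simp [(G e.1).inv_inv]
  inv_ne := by
    rintro ⟨i, e⟩ h
    exact (G i).inv_ne e (by simpa using h)
  tau e := ⟨e.1, (G e.1).tau e.2⟩

/-- The cycle of length `n`: the vertex set is `ZMod n`, and `(i, true)`, `(i, false)` are the two
orientations of the edge between `i` and `i + 1`. For `n = 1` this is a loop, for `n = 2` a pair of
parallel edges, and for `n = 0`, where `ZMod 0 = ℤ`, it is the infinite cycle, that is, the
two-way infinite path. -/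
def cycle (n : ℕ) : SerreGraph.{0} where
  V := ZMod n
  E := ZMod n × Bool
  inv e := (e.1, !e.2)
  inv_inv e := by simp
  inv_ne e h := by
    have := congrArg Prod.snd h
    simp at this
  tau e := if e.2 then e.1 + 1 else e.1

/-- Two vertices joined by one edge; the directed edge `b` ends at the vertex `b`. -/
def singleEdge : SerreGraph.{0} where
  V := Bool
  E := Bool
  inv e := !e
  inv_inv e := by simp
  inv_ne e := by simp
  tau e := e

/-- A vertex-disjoint union of (finite or infinite) cycles and single edges. -/
def IsWeakMulticycle (G : SerreGraph.{u}) : Prop :=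
  ∃ (ι : Type u) (H : ι → SerreGraph.{0}),
    (∀ i, (∃ n : ℕ, Nonempty (Iso (H i) (cycle n))) ∨ Nonempty (Iso (H i) singleEdge)) ∧
      Nonempty (Iso G (disjUnion H))

/-- The graph with vertex set `V(G)` whose edges are those of colour `a`. -/
def colourClass (G : SerreGraph.{u}) {Ω : Type u} (c : G.UEdge → Ω) (a : Ω) : SerreGraph.{u} where
  V := G.V
  E := {e : G.E // c (G.toUEdge e) = a}
  inv e := ⟨G.inv e.1, by rw [G.toUEdge_inv]; exact e.2⟩
  inv_inv e := Subtype.ext (G.inv_inv e.1)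
  inv_ne e h := G.inv_ne e.1 (congrArg Subtype.val h)
  tau e := G.tau e.1

def IsWeakMulticycleColouring (G : SerreGraph.{u}) {Ω : Type u} (c : G.UEdge → Ω) : Prop :=
  ∀ a, (G.colourClass c a).IsWeakMulticycle

def IsPartitionFriendly (G : SerreGraph.{u}) {Ω : Type u} (c : G.UEdge → Ω) : Prop :=
  ∀ a, (G.colourClass c a).IsRegular

end SerreGraph

/-- The group `⟨U ∪ I | i² (i ∈ I)⟩`, the free product of infinite cyclic groups, one for each
element of `U`, and cyclic groups of order two, one for each element of `I`. -/
abbrev MixedFreeGroup (U I : Type u) : Type u :=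
  PresentedGroup {r : FreeGroup (U ⊕ I) | ∃ i : I, r = FreeGroup.of (Sum.inr i) ^ 2}

/-- The right action of the group on `X` induced by permutations `φ(s)` of `X`:
`x · (s₁ ⋯ sₙ) = φ(sₙ) (⋯ (φ(s₁) x))`, so that words are read along walks. -/
def mixedAction {X U I : Type u} (φ : U ⊕ I → Equiv.Perm X)
    (hφ : ∀ i x, φ (Sum.inr i) (φ (Sum.inr i) x) = x) :
    MixedFreeGroup U I →* (Equiv.Perm X)ᵐᵒᵖ :=
  PresentedGroup.toGroup (f := fun s => MulOpposite.op (φ s)) (by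
    rintro r ⟨i, rfl⟩
    rw [map_pow, FreeGroup.lift_apply_of, ← MulOpposite.op_pow, ← MulOpposite.op_one]
    congr 1
    ext x
    simp [pow_two, hφ])

/-- A partite presentation `⟨X | U | I | φ | R⟩`. -/
structure PartitePresentation where
  /-- the vertex classes -/
  X : Type u
  U : Type u
  I : Type u
  nonempty : Nonempty X
  φ : U ⊕ I → Equiv.Perm X
  /-- `φ(i)` is a fixed point free involution for `i ∈ I` -/
  φ_invol : ∀ i x, φ (Sum.inr i) (φ (Sum.inr i) x) = x
  φ_fixfree : ∀ i x, φ (Sum.inr i) x ≠ x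
  transitive : ∀ x y, ∃ g : MixedFreeGroup U I, (mixedAction φ φ_invol g).unop x = y
  /-- the relator sets, contained in the stabilisers -/
  R : X → Set (MixedFreeGroup U I)
  R_stab : ∀ x, ∀ r ∈ R x, (mixedAction φ φ_invol r).unop x = x

namespace PartitePresentation

variable (P : PartitePresentation.{u})

abbrev MF : Type u := MixedFreeGroup P.U P.I

/-- `x · g`. -/
def act (x : P.X) (g : P.MF) : P.X := (mixedAction P.φ P.φ_invol g).unop x

theorem act_one (x : P.X) : P.act x 1 = x := by
  simp [act]

theorem act_mul (x : P.X) (g h : P.MF) : P.act x (g * h) = P.act (P.act x g) h := by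
  simp [act]

theorem act_of (x : P.X) (s : P.U ⊕ P.I) : P.act x (PresentedGroup.of s) = P.φ s x := by
  simp [act, mixedAction, PresentedGroup.toGroup.of]

/-- The set `S ∪ S⁻¹` of letters, where `S = U ∪ I`: `inl (u, true)` is `u`, `inl (u, false)` is
`u⁻¹`, and `inr i` is `i = i⁻¹`. -/
abbrev Letter : Type u := (P.U × Bool) ⊕ P.I

def Letter.inv : P.Letter → P.Letter
  | Sum.inl (a, b) => Sum.inl (a, !b)
  | Sum.inr i => Sum.inr i

/-- The group element denoted by a letter. -/
def Letter.val : P.Letter → P.MF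
  | Sum.inl (a, true) => PresentedGroup.of (Sum.inl a)
  | Sum.inl (a, false) => (PresentedGroup.of (Sum.inl a))⁻¹
  | Sum.inr i => PresentedGroup.of (Sum.inr i)

theorem Letter.inv_inv (s : P.Letter) : Letter.inv P (Letter.inv P s) = s := by
  rcases s with ⟨a, b⟩ | i <;> simp [Letter.inv]

theorem Letter.val_inv (s : P.Letter) : Letter.val P (Letter.inv P s) = (Letter.val P s)⁻¹ := by
  rcases s with ⟨a, b | b⟩ | i
  · simp [Letter.inv, Letter.val]
  · simp [Letter.inv, Letter.val]
  · have h : (PresentedGroup.of (Sum.inr i) : P.MF) ^ 2 = 1 :=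
      PresentedGroup.one_of_mem ⟨i, rfl⟩
    simp only [Letter.inv, Letter.val]
    exact eq_inv_of_mul_eq_one_left (by rw [← pow_two, h])

theorem Letter.act_ne {s : P.Letter} (hs : Letter.inv P s = s) (x : P.X) :
    P.act x (Letter.val P s) ≠ x := by
  rcases s with ⟨a, b⟩ | i
  · simp [Letter.inv] at hs
  · simp only [Letter.val, act_of]
    exact P.φ_fixfree i x

/-- The tree `T_P`: the vertices are the group elements, and `(w, s)` is the directed edge from `w`
to `w s`, which has colour `s`. -/
def tree : SerreGraph.{u} where
  V := P.MF
  E := P.MF × P.Letter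
  inv e := (e.1 * Letter.val P e.2, Letter.inv P e.2)
  inv_inv e := by simp [Letter.val_inv, Letter.inv_inv]
  inv_ne e h := by
    have h1 := congrArg Prod.fst h
    have h2 := congrArg Prod.snd h
    dsimp only at h1 h2
    have h3 := P.act_mul (Classical.choice P.nonempty) e.1 (Letter.val P e.2)
    rw [h1] at h3
    exact Letter.act_ne P h2 _ h3.symm
  tau e := e.1 * Letter.val P e.2

theorem tree_tau_inv (e : P.tree.E) : P.tree.tau (P.tree.inv e) = e.1 := by
  simp [tree, Letter.val_inv]

/-- The subgroup `R_x`, generated by all `w r w⁻¹` with `y = x · w` and `r` a relator at `y`. -/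
def relSubgroup (x : P.X) : Subgroup P.MF :=
  Subgroup.closure {g | ∃ w : P.MF, ∃ r ∈ P.R (P.act x w), g = w * r * w⁻¹}

/-- With base class `b`, the class of `g ∈ V(T_P)` is `b · g`. Two vertices are equivalent if they
have the same class `x` and `g⁻¹ h ∈ R_x`. -/
def vertexSetoid (b : P.X) : Setoid P.MF where
  r g h := P.act b g = P.act b h ∧ g⁻¹ * h ∈ P.relSubgroup (P.act b g)
  iseqv :=
    { refl := fun g => ⟨rfl, by
        rw [inv_mul_cancel]
        exact one_mem _⟩
      symm := by
        rintro g h ⟨h1, h2⟩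
        refine ⟨h1.symm, ?_⟩
        have h3 := inv_mem h2
        rw [mul_inv_rev, inv_inv, h1] at h3
        exact h3
      trans := by
        rintro g h k ⟨h1, h2⟩ ⟨h3, h4⟩
        refine ⟨h1.trans h3, ?_⟩
        rw [← h1] at h4
        have h5 := mul_mem h2 h4
        rw [mul_assoc, mul_inv_cancel_left] at h5
        exact h5 }

/-- Two directed edges `e`, `f` of `T_P` are equivalent if they have the same colour, equivalent
termini, and equivalent initial vertices (the vertices `e.1` and `f.1`, see `tree_tau_inv`). -/
def edgeSetoid (b : P.X) : Setoid (P.MF × P.Letter) where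
  r e f := e.2 = f.2 ∧
    P.vertexSetoid b (e.1 * Letter.val P e.2) (f.1 * Letter.val P f.2) ∧
    P.vertexSetoid b e.1 f.1
  iseqv :=
    { refl := fun _ => ⟨rfl, Setoid.refl' _ _, Setoid.refl' _ _⟩
      symm := fun h => ⟨h.1.symm, Setoid.symm' _ h.2.1, Setoid.symm' _ h.2.2⟩
      trans := fun h k => ⟨h.1.trans k.1, Setoid.trans' _ h.2.1 k.2.1,
        Setoid.trans' _ h.2.2 k.2.2⟩ }

/-- The partite Cayley graph, as the quotient of `T_P`, with respect to the base class `b`. -/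
def SpAt (b : P.X) : SerreGraph.{u} where
  V := Quotient (P.vertexSetoid b)
  E := Quotient (P.edgeSetoid b)
  inv := Quotient.map (sa := P.edgeSetoid b) (sb := P.edgeSetoid b) P.tree.inv (by
    rintro ⟨g, s⟩ ⟨h, t⟩ ⟨h1, h2, h3⟩
    dsimp only at h1 h2 h3
    subst h1
    refine ⟨rfl, ?_, h2⟩
    simpa [tree, Letter.val_inv] using h3)
  inv_inv := by
    rintro ⟨e⟩
    exact congrArg (Quotient.mk (P.edgeSetoid b)) (P.tree.inv_inv e)
  inv_ne := by
    rintro ⟨e⟩ h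
    have h' : P.edgeSetoid b (P.tree.inv e) e := Quotient.exact h
    obtain ⟨h1, -, h2⟩ := h'
    have h3 : P.act b (e.1 * Letter.val P e.2) = P.act b e.1 := h2.1
    rw [act_mul] at h3
    exact Letter.act_ne P h1 _ h3
  tau := Quotient.map (sa := P.edgeSetoid b) (sb := P.vertexSetoid b) P.tree.tau
    (fun _ _ h => h.2.1)

/-- The partite Cayley graph `Sp(P)`. The base class is immaterial, see `SpAt_iso`. -/
noncomputable def Sp : SerreGraph.{u} := P.SpAt (Classical.choice P.nonempty)

theorem vertexSetoid_mul (b : P.X) (k g h : P.MF) :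
    P.vertexSetoid b (k * g) (k * h) ↔ P.vertexSetoid (P.act b k) g h := by
  change (P.act b (k * g) = P.act b (k * h) ∧
      (k * g)⁻¹ * (k * h) ∈ P.relSubgroup (P.act b (k * g))) ↔
    (P.act (P.act b k) g = P.act (P.act b k) h ∧
      g⁻¹ * h ∈ P.relSubgroup (P.act (P.act b k) g))
  rw [act_mul, act_mul, mul_inv_rev, mul_assoc, inv_mul_cancel_left]

theorem SpAt_iso (b b' : P.X) : Nonempty (SerreGraph.Iso (P.SpAt b) (P.SpAt b')) := by
  obtain ⟨k, hk⟩ := P.transitive b' b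
  change P.act b' k = b at hk
  subst hk
  have hE : ∀ e f : P.MF × P.Letter, P.edgeSetoid (P.act b' k) e f ↔
      P.edgeSetoid b' (k * e.1, e.2) (k * f.1, f.2) := by
    intro e f
    change (e.2 = f.2 ∧ P.vertexSetoid _ _ _ ∧ P.vertexSetoid _ _ _) ↔
      (e.2 = f.2 ∧ P.vertexSetoid b' (k * e.1 * _) (k * f.1 * _) ∧
        P.vertexSetoid b' (k * e.1) (k * f.1))
    rw [mul_assoc, mul_assoc, vertexSetoid_mul, vertexSetoid_mul]
  refine ⟨⟨Quotient.congr (Equiv.mulLeft k) fun g h => (P.vertexSetoid_mul b' k g h).symm,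
    Quotient.congr ((Equiv.mulLeft k).prodCongr (Equiv.refl _)) hE, ?_, ?_⟩⟩
  · rintro ⟨e⟩
    refine congrArg (Quotient.mk (P.edgeSetoid b')) (Prod.ext ?_ rfl)
    exact (mul_assoc k e.1 (Letter.val P e.2)).symm
  · rintro ⟨e⟩
    exact congrArg (Quotient.mk (P.vertexSetoid b')) (mul_assoc k e.1 (Letter.val P e.2)).symm

end PartitePresentation

/-!
Call a labelling of the directed edges of a graph by a set `A` with an inversion *deterministic* if
it respects inversion and every vertex is the origin of exactly one edge of each label. Such a
labelled graph is determined by the permutations of its vertices that follow the edges of a given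
label. With `A = {+, -}`, `+⁻¹ = -`, it is a permutation, whose orbits are cycles; with `A = {*}` it
is a fixed point free involution, whose orbits are single edges. Hence partition-friendly weak
multicycle colourings amount to deterministic labellings by letters `S ∪ S⁻¹`: a regular weak
multicycle is either 2-regular, and its cycles can be oriented, or 1-regular. On the other side,
`Sp(P)` is deterministically labelled by colours, and a connected labelled graph is `Sp(P)` for the
presentation with one class per vertex and the whole stabiliser of each class as relators.
-/

open Function Cardinal

universe w w'

theorem exists_equiv_sigma_zmod_add_one {V : Type u} (σ : Equiv.Perm V) :
    ∃ (ι : Type u) (n : ι → ℕ) (f : (Σ i, ZMod (n i)) ≃ V), ∀ i k, f ⟨i, k + 1⟩ = σ (f ⟨i, k⟩) := by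
  let orbitEquiv (ω : MulAction.orbitRel.Quotient (Subgroup.zpowers σ) V) :=
    (MulAction.orbitZPowersEquiv σ ω.out).symm
  have coe_orbitEquiv (ω) (j : ℤ) : (orbitEquiv ω j : V) = (σ ^ j) ω.out := by
    rw [MulAction.orbitZPowersEquiv_symm_apply']
    rfl
  refine ⟨_, _, (Equiv.sigmaCongrRight orbitEquiv).trans
    (MulAction.selfEquivSigmaOrbits (Subgroup.zpowers σ) V).symm, fun ω k => ?_⟩
  obtain ⟨j, rfl⟩ := ZMod.intCast_surjective k
  change (orbitEquiv ω (j + 1) : V) = σ (orbitEquiv ω j)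
  rw [← Int.cast_one, ← Int.cast_add, coe_orbitEquiv, coe_orbitEquiv, add_comm, zpow_add, zpow_one,
    Equiv.Perm.mul_apply]

theorem exists_equiv_sigma_bool_not {V : Type u} (σ : Equiv.Perm V) (hσ : Involutive σ)
    (hne : ∀ x, σ x ≠ x) :
    ∃ (ι : Type u) (f : (Σ _ : ι, Bool) ≃ V), ∀ i b, f ⟨i, !b⟩ = σ (f ⟨i, b⟩) := by
  obtain ⟨ι, n, f, hf⟩ := exists_equiv_sigma_zmod_add_one σ
  obtain rfl : n = fun _ => 2 := by
    funext i
    have two_eq_zero : ((2 : ℕ) : ZMod (n i)) = 0 := by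
      have h : f ⟨i, 0 + 1 + 1⟩ = f ⟨i, 0⟩ := by rw [hf, hf, hσ]
      have h' : (0 + 1 + 1 : ZMod (n i)) = 0 := eq_of_heq (Sigma.mk.inj (f.injective h)).2
      rw [← h']
      norm_num
    have ne_one : n i ≠ 1 := by
      intro h
      have : Subsingleton (ZMod (n i)) := by rw [h]; infer_instance
      exact hne (f ⟨i, 0⟩) (by rw [← hf, Subsingleton.elim (0 + 1) (0 : ZMod (n i))])
    have dvd_two : n i ∣ 2 := (ZMod.natCast_eq_zero_iff 2 _).1 two_eq_zero
    exact ((Nat.dvd_prime Nat.prime_two).1 dvd_two).resolve_left ne_one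
  have finTwoEquiv_symm_not : ∀ b, finTwoEquiv.symm (!b) = finTwoEquiv.symm b + 1 := by decide
  refine ⟨ι, (Equiv.sigmaCongrRight fun _ => finTwoEquiv.symm).trans f, fun i b => ?_⟩
  change f ⟨i, finTwoEquiv.symm (!b)⟩ = σ (f ⟨i, finTwoEquiv.symm b⟩)
  rw [finTwoEquiv_symm_not]
  exact hf i _

namespace SerreGraph

variable {G : SerreGraph.{u}} {H : SerreGraph.{v}}

/-- The initial vertex of a directed edge. -/
def source (G : SerreGraph.{u}) (e : G.E) : G.V := G.tau (G.inv e)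

theorem source_inv (e : G.E) : G.source (G.inv e) = G.tau e := by
  rw [source, G.inv_inv]

theorem Iso.map_source (f : Iso G H) (e : G.E) : f.onV (G.source e) = H.source (f.onE e) := by
  rw [source, f.map_tau, f.map_inv, source]

def Iso.refl (G : SerreGraph.{u}) : Iso G G where
  onV := Equiv.refl _
  onE := Equiv.refl _
  map_inv _ := rfl
  map_tau _ := rfl

def Iso.symm (f : Iso G H) : Iso H G where
  onV := f.onV.symm
  onE := f.onE.symm
  map_inv e := by rw [Equiv.symm_apply_eq, f.map_inv, Equiv.apply_symm_apply]
  map_tau e := by rw [Equiv.symm_apply_eq, f.map_tau, Equiv.apply_symm_apply]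

theorem Iso.lift_degree (f : Iso G H) (x : G.V) :
    lift.{v} (G.degree x) = lift.{u} (H.degree (f.onV x)) :=
  mk_congr_lift (f.onE.subtypeEquiv fun e => by rw [← f.map_tau, f.onV.apply_eq_iff_eq])

theorem degree_disjUnion {ι : Type u} (H : ι → SerreGraph.{v}) (i : ι) (x : (H i).V) :
    (disjUnion H).degree ⟨i, x⟩ = lift.{u} ((H i).degree x) := by
  let incl (e : {e // (H i).tau e = x}) : {e // (disjUnion H).tau e = ⟨i, x⟩} :=
    ⟨⟨i, e.1⟩, congrArg (Sigma.mk i) e.2⟩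
  have incl_bijective : Bijective incl := by
    constructor
    · intro e e' h
      exact Subtype.ext (eq_of_heq (Sigma.mk.inj (congrArg Subtype.val h)).2)
    · rintro ⟨⟨j, e⟩, h⟩
      obtain rfl : j = i := congrArg Sigma.fst h
      exact ⟨⟨e, eq_of_heq (Sigma.mk.inj h).2⟩, rfl⟩
  exact mk_congr ((Equiv.ofBijective incl incl_bijective).symm.trans Equiv.ulift.symm)

/-- A deterministic labelling of the directed edges by a set `A` with inversion `ι`: it respects
inversion, and every vertex is the initial vertex of exactly one edge of each label. In other words,
a covering map onto the graph with one vertex and directed edges `A`, in which the fixed points of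
`ι` are half-edges. -/
structure Labelling (G : SerreGraph.{u}) {A : Type w} (ι : A → A) where
  label : G.E → A
  label_inv : ∀ e, label (G.inv e) = ι (label e)
  bijective : Bijective fun e => (G.source e, label e)

namespace Labelling

variable {A : Type w} {ι : A → A} (L : G.Labelling ι)

/-- A directed edge amounts to its initial vertex together with its label. -/
noncomputable def edgeEquiv : G.E ≃ G.V × A := Equiv.ofBijective _ L.bijective

/-- The edge with initial vertex `x` and label `s`. -/
noncomputable def edge (x : G.V) (s : A) : G.E := L.edgeEquiv.symm (x, s)

theorem source_edge (x : G.V) (s : A) : G.source (L.edge x s) = x :=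
  congrArg Prod.fst (L.edgeEquiv.apply_symm_apply (x, s))

theorem label_edge (x : G.V) (s : A) : L.label (L.edge x s) = s :=
  congrArg Prod.snd (L.edgeEquiv.apply_symm_apply (x, s))

theorem edge_source_label (e : G.E) : L.edge (G.source e) (L.label e) = e :=
  L.edgeEquiv.symm_apply_apply e

/-- The terminal vertex of the edge with initial vertex `x` and label `s`. -/
noncomputable def next (s : A) (x : G.V) : G.V := G.tau (L.edge x s)

theorem next_label_source (e : G.E) : L.next (L.label e) (G.source e) = G.tau e := by
  rw [next, edge_source_label]

theorem inv_edge (x : G.V) (s : A) : G.inv (L.edge x s) = L.edge (L.next s x) (ι s) := by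
  rw [← L.edge_source_label (G.inv _), source_inv, L.label_inv, L.label_edge, next]

theorem leftInverse_next (s : A) : LeftInverse (L.next (ι s)) (L.next s) := by
  intro x
  rw [next, ← inv_edge]
  exact L.source_edge x s

theorem rightInverse_next (s : A) : RightInverse (L.next (ι s)) (L.next s) := by
  intro x
  have inv_inv : ι (ι s) = s := by
    rw [← L.label_edge x s, ← L.label_inv, ← L.label_inv, G.inv_inv]
  simpa only [inv_inv] using L.leftInverse_next (ι s) x

theorem next_ne_self {s : A} (hs : ι s = s) (x : G.V) : L.next s x ≠ x := by
  intro h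
  have inv_edge_self := L.inv_edge x s
  rw [h, hs] at inv_edge_self
  exact G.inv_ne _ inv_edge_self

/-- The permutation of the vertices that follows the edges labelled `s`. -/
noncomputable def perm (s : A) : Equiv.Perm G.V where
  toFun := L.next s
  invFun := L.next (ι s)
  left_inv := L.leftInverse_next s
  right_inv := L.rightInverse_next s

/-- The edges ending at `x` correspond to the labels of their inverses, which start at `x`. -/
noncomputable def inEdgesEquiv (x : G.V) : {e // G.tau e = x} ≃ A where
  toFun e := L.label (G.inv e)
  invFun s := ⟨G.inv (L.edge x s), L.source_edge x s⟩
  left_inv := by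
    rintro ⟨e, rfl⟩
    apply Subtype.ext
    change G.inv (L.edge (G.tau e) (L.label (G.inv e))) = e
    rw [← source_inv, edge_source_label, G.inv_inv]
  right_inv s := by
    change L.label (G.inv (G.inv (L.edge x s))) = s
    rw [G.inv_inv, label_edge]

theorem lift_degree (L : G.Labelling ι) (x : G.V) : lift.{w} (G.degree x) = lift.{u} #A :=
  mk_congr_lift (L.inEdgesEquiv x)

theorem isRegular (L : G.Labelling ι) : G.IsRegular := by
  rcases isEmpty_or_nonempty G.V with _ | ⟨⟨x₀⟩⟩
  · exact ⟨0, isEmptyElim⟩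
  · exact ⟨G.degree x₀, fun x => mk_congr ((L.inEdgesEquiv x).trans (L.inEdgesEquiv x₀).symm)⟩

/-- A deterministically labelled graph is determined by the permutations `next s`. -/
noncomputable def isoOfSemiconj (M : H.Labelling ι) (f : G.V ≃ H.V)
    (hf : ∀ s, Semiconj f (L.next s) (M.next s)) : Iso G H where
  onV := f
  onE := (L.edgeEquiv.trans (f.prodCongr (Equiv.refl A))).trans M.edgeEquiv.symm
  map_inv e := by
    change M.edge (f (G.source (G.inv e))) (L.label (G.inv e)) =
      H.inv (M.edge (f (G.source e)) (L.label e))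
    rw [inv_edge, ← hf, next_label_source, source_inv, label_inv]
  map_tau e := by
    change f (G.tau e) = M.next (L.label e) (f (G.source e))
    rw [← hf, next_label_source]

/-- The pullback of a labelling along an isomorphism. -/
def comap (f : Iso H G) : H.Labelling ι where
  label e := L.label (f.onE e)
  label_inv e := by rw [f.map_inv, L.label_inv]
  bijective := by
    have : (fun e => (H.source e, L.label (f.onE e))) =
        Prod.map f.onV.symm id ∘ (fun e => (G.source e, L.label e)) ∘ f.onE := by
      funext e
      simp [← f.map_source]
    rw [this]
    exact (f.onV.symm.bijective.prodMap bijective_id).comp (L.bijective.comp f.onE.bijective)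

/-- Renaming of the labels by an equivariant bijection. -/
def relabel {B : Type w'} {κ : B → B} (φ : A ≃ B) (hφ : Semiconj φ ι κ) : G.Labelling κ where
  label e := φ (L.label e)
  label_inv e := by rw [L.label_inv, hφ]
  bijective := (bijective_id.prodMap φ.bijective).comp L.bijective

/-- The labelling of a disjoint union given by labellings of the components. -/
def disjUnion {J : Type u} {H : J → SerreGraph.{v}} (L : ∀ j, (H j).Labelling ι) :
    (disjUnion H).Labelling ι where
  label e := (L e.1).label e.2
  label_inv e := (L e.1).label_inv e.2
  bijective := by
    constructor
    · rintro ⟨i, e⟩ ⟨j, e'⟩ h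
      obtain ⟨hsource, hlabel⟩ := Prod.mk.inj h
      obtain rfl : i = j := congrArg Sigma.fst hsource
      exact congrArg (Sigma.mk i) ((L i).bijective.injective
        (Prod.ext (eq_of_heq (Sigma.mk.inj hsource).2) hlabel))
    · rintro ⟨⟨i, x⟩, s⟩
      exact ⟨⟨i, (L i).edge x s⟩,
        Prod.ext (congrArg (Sigma.mk i) ((L i).source_edge x s)) ((L i).label_edge x s)⟩

end Labelling

section ColourClass

variable {A : Type w} {ι : A → A} {Ω : Type u} {κ : A → Ω}

/-- The inversion of the letters of colour `a`. -/
def fibreInv (hκ : ∀ s, κ (ι s) = κ s) (a : Ω) : {s // κ s = a} → {s // κ s = a} :=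
  Subtype.map ι fun s hs => (hκ s).trans hs

namespace Labelling

/-- The colouring of the undirected edges by the colours `κ` of their labels. -/
def colouring (L : G.Labelling ι) (hκ : ∀ s, κ (ι s) = κ s) : G.UEdge → Ω :=
  Quot.lift (fun e => κ (L.label e)) (by
    rintro e _ rfl
    rw [L.label_inv, hκ])

/-- The edges of colour `a` are deterministically labelled by the letters of colour `a`. -/
def restrict (L : G.Labelling ι) (hκ : ∀ s, κ (ι s) = κ s) (a : Ω) :
    (G.colourClass (L.colouring hκ) a).Labelling (fibreInv hκ a) where
  label e := ⟨L.label e.1, e.2⟩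
  label_inv e := Subtype.ext (L.label_inv e.1)
  bijective := by
    constructor
    · rintro e e' h
      obtain ⟨hsource, hlabel⟩ := Prod.mk.inj h
      exact Subtype.ext (L.bijective.injective (Prod.ext hsource (congrArg Subtype.val hlabel)))
    · rintro ⟨x, s, hs⟩
      exact ⟨⟨L.edge x s, (congrArg κ (L.label_edge x s)).trans hs⟩,
        Prod.ext (L.source_edge x s) (Subtype.ext (L.label_edge x s))⟩

/-- The converse of `restrict`: deterministic labellings of all colour classes, by the letters of
their respective colours, combine to a deterministic labelling of the graph. -/
def glue {c : G.UEdge → Ω} (hκ : ∀ s, κ (ι s) = κ s)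
    (L : ∀ a, (G.colourClass c a).Labelling (fibreInv hκ a)) : G.Labelling ι := by
  let label (e : G.E) : A := (L (c (G.toUEdge e))).label ⟨e, rfl⟩
  have label_eq {a} (e : (G.colourClass c a).E) : label e.1 = (L a).label e := by
    obtain ⟨e, rfl⟩ := e
    rfl
  refine ⟨label, fun e => ?_, ?_, ?_⟩
  · let e' : (G.colourClass c (c (G.toUEdge e))).E := ⟨e, rfl⟩
    exact (label_eq ((G.colourClass c _).inv e')).trans (congrArg Subtype.val ((L _).label_inv e'))
  · intro e e' h
    obtain ⟨hsource, hlabel⟩ := Prod.mk.inj h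
    have colour_eq : c (G.toUEdge e) = c (G.toUEdge e') := by
      rw [← ((L _).label ⟨e, rfl⟩).2, ← ((L _).label ⟨e', rfl⟩).2]
      exact congrArg κ hlabel
    have h' : (⟨e, colour_eq⟩ : (G.colourClass c _).E) = ⟨e', rfl⟩ :=
      (L _).bijective.injective (Prod.ext hsource
        (Subtype.ext ((label_eq ⟨e, colour_eq⟩).symm.trans hlabel)))
    exact congrArg Subtype.val h'
  · rintro ⟨x, s⟩
    let e := (L (κ s)).edge x ⟨s, rfl⟩
    refine ⟨e.1, Prod.ext ((L _).source_edge x _) ?_⟩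
    exact (label_eq e).trans (congrArg Subtype.val ((L _).label_edge x ⟨s, rfl⟩))

end Labelling

def colourClassCompIso {Ω' : Type u} (c : G.UEdge → Ω) (f : Ω ≃ Ω') (a : Ω') :
    Iso (G.colourClass (f ∘ c) a) (G.colourClass c (f.symm a)) where
  onV := Equiv.refl _
  onE := Equiv.subtypeEquivRight fun _ => f.eq_symm_apply.symm
  map_inv _ := rfl
  map_tau _ := rfl

end ColourClass

/-- An orientation in which every vertex has one outgoing and one incoming edge: the label of a
directed edge tells whether its direction agrees with the orientation. -/
abbrev CyclicOrientation (G : SerreGraph.{u}) : Type u := G.Labelling Bool.not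

/-- A perfect matching by the edges of the graph, encoded as the labelling by a single self-inverse
label: every vertex is the initial vertex of exactly one directed edge. -/
abbrev PerfectMatching (G : SerreGraph.{u}) : Type u := G.Labelling (id : Unit → Unit)

/-- The orientation of a cycle from `i` to `i + 1`. -/
def cycleOrientation (n : ℕ) : (cycle n).CyclicOrientation where
  label := Prod.snd
  label_inv _ := rfl
  bijective := by
    constructor
    · rintro ⟨k, b⟩ ⟨l, b'⟩ h
      obtain ⟨hsource, rfl : b = b'⟩ := Prod.mk.inj h
      cases b
      · exact Prod.ext (add_right_cancel (show (k + 1 : ZMod n) = l + 1 from hsource)) rfl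
      · exact Prod.ext hsource rfl
    · rintro ⟨(k : ZMod n), _ | _⟩
      · exact ⟨(k - 1, false), Prod.ext (sub_add_cancel k 1) rfl⟩
      · exact ⟨(k, true), rfl⟩

/-- The perfect matching of a single edge by itself. -/
def singleEdgeMatching : singleEdge.PerfectMatching where
  label _ := ()
  label_inv _ := rfl
  bijective := by
    constructor
    · intro b b' h
      exact Bool.not_inj (congrArg Prod.fst h)
    · rintro ⟨b, _⟩
      exact ⟨!b, Prod.ext (Bool.not_not b) rfl⟩

theorem CyclicOrientation.isWeakMulticycle (L : G.CyclicOrientation) : G.IsWeakMulticycle := by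
  obtain ⟨ι, n, f, hf⟩ := exists_equiv_sigma_zmod_add_one (L.perm true)
  let M := Labelling.disjUnion fun i => cycleOrientation (n i)
  have semiconj_true : Semiconj f (M.next true) (L.next true) := fun ⟨i, k⟩ =>
    (congrArg f (M.next_label_source ⟨i, k, true⟩)).trans (hf i k)
  refine ⟨ι, fun i => cycle (n i), fun i => Or.inl ⟨n i, ⟨Iso.refl _⟩⟩,
    ⟨(M.isoOfSemiconj L f ?_).symm⟩⟩
  rintro (_ | _)
  · exact semiconj_true.inverses_right (M.rightInverse_next true) (L.leftInverse_next true)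
  · exact semiconj_true

theorem PerfectMatching.isWeakMulticycle (L : G.PerfectMatching) : G.IsWeakMulticycle := by
  obtain ⟨ι, f, hf⟩ := exists_equiv_sigma_bool_not (L.perm ()) (L.leftInverse_next ())
    (L.next_ne_self rfl)
  let M := Labelling.disjUnion fun _ : ι => singleEdgeMatching
  refine ⟨ι, fun _ => singleEdge, fun _ => Or.inr ⟨Iso.refl _⟩,
    ⟨(M.isoOfSemiconj L f fun _ ⟨i, b⟩ => ?_).symm⟩⟩
  obtain ⟨b, rfl⟩ := Bool.not_surjective b
  exact (congrArg f (M.next_label_source ⟨i, b⟩)).trans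
    ((congrArg (fun b => f ⟨i, b⟩) (Bool.not_not b).symm).trans (hf i !b))

theorem nonempty_perfectMatching_of_degree_eq_one (h : ∀ x, G.degree x = 1) :
    Nonempty G.PerfectMatching := by
  have h' x := eq_one_iff_unique.1 (h x)
  refine ⟨fun _ => (), fun _ => rfl, fun e e' hsource => ?_, fun ⟨x, _⟩ => ?_⟩
  · have inv_eq : (⟨G.inv e, rfl⟩ : {f // G.tau f = G.source e}) =
        ⟨G.inv e', (congrArg Prod.fst hsource).symm⟩ := (h' _).1.elim _ _
    have inv_eq' : G.inv e = G.inv e' := congrArg Subtype.val inv_eq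
    rw [← G.inv_inv e, inv_eq', G.inv_inv]
  · obtain ⟨e, rfl⟩ := (h' x).2
    exact ⟨G.inv e, Prod.ext (G.source_inv e) rfl⟩

/-- A vertex on a component that is a single edge has degree one, so by regularity all vertices
have. -/
theorem IsWeakMulticycle.cyclicOrientation_or_perfectMatching (h : G.IsWeakMulticycle)
    (hr : G.IsRegular) : Nonempty G.CyclicOrientation ∨ Nonempty G.PerfectMatching := by
  obtain ⟨ι, H, hH, ⟨f⟩⟩ := h
  by_cases all_cycles : ∀ i, ∃ n : ℕ, Nonempty (Iso (H i) (cycle n))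
  · choose n g using all_cycles
    exact Or.inl ⟨(Labelling.disjUnion fun i => (cycleOrientation (n i)).comap (g i).some).comap f⟩
  · obtain ⟨i, hi⟩ := not_forall.1 all_cycles
    obtain ⟨g⟩ := (hH i).resolve_left hi
    obtain ⟨k, hk⟩ := hr
    let x : (disjUnion H).V := ⟨i, g.symm.onV true⟩
    have degree_x : (disjUnion H).degree x = 1 := by
      have degree_component := ((singleEdgeMatching.comap g).lift_degree (g.symm.onV true))
      rw [lift_id, mk_unit, lift_one] at degree_component
      exact (degree_disjUnion H i _).trans (by rw [degree_component, lift_one])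
    obtain rfl : k = 1 := by
      rw [← hk (f.symm.onV x)]
      simpa only [lift_id, degree_x] using (f.symm.lift_degree x).symm
    exact Or.inr (nonempty_perfectMatching_of_degree_eq_one hk)

theorem isWeakMulticycle_and_isRegular_iff :
    G.IsWeakMulticycle ∧ G.IsRegular ↔
      Nonempty G.CyclicOrientation ∨ Nonempty G.PerfectMatching := by
  constructor
  · rintro ⟨hG, hr⟩
    exact hG.cyclicOrientation_or_perfectMatching hr
  · rintro (⟨⟨L⟩⟩ | ⟨⟨L⟩⟩)
    · exact ⟨L.isWeakMulticycle, L.isRegular⟩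
    · exact ⟨L.isWeakMulticycle, L.isRegular⟩

end SerreGraph

/-- The letters `S ∪ S⁻¹` for `S = U ∪ I`, encoded as in `PartitePresentation.Letter`. -/
abbrev MixedLetter (U I : Type u) : Type u := (U × Bool) ⊕ I

namespace MixedLetter

variable {U I : Type u}

/-- The formal inverse of a letter. -/
def inv : MixedLetter U I → MixedLetter U I := Sum.map (Prod.map id Bool.not) id

/-- The generator `s` underlying the letters `s` and `s⁻¹`. -/
def generator : MixedLetter U I → U ⊕ I := Sum.map Prod.fst id

/-- The group element denoted by a letter, as in `PartitePresentation.Letter.val`. -/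
def val : MixedLetter U I → MixedFreeGroup U I
  | Sum.inl (u, true) => PresentedGroup.of (Sum.inl u)
  | Sum.inl (u, false) => (PresentedGroup.of (Sum.inl u))⁻¹
  | Sum.inr i => PresentedGroup.of (Sum.inr i)

theorem generator_inv (s : MixedLetter U I) : generator (inv s) = generator s := by
  rcases s with ⟨u, b⟩ | i <;> rfl

/-- The letters `u` and `u⁻¹`, as signs. -/
def fibreInlEquiv (u : U) : {s : MixedLetter U I // generator s = Sum.inl u} ≃ Bool where
  toFun
    | ⟨Sum.inl (_, b), _⟩ => b
  invFun b := ⟨Sum.inl (u, b), rfl⟩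
  left_inv := by
    rintro ⟨⟨_, b⟩ | i, h⟩
    · obtain rfl := Sum.inl.inj h
      rfl
    · cases h
  right_inv _ := rfl

def fibreInrEquiv (i : I) : {s : MixedLetter U I // generator s = Sum.inr i} ≃ Unit where
  toFun _ := ()
  invFun _ := ⟨Sum.inr i, rfl⟩
  left_inv := by
    rintro ⟨⟨_, b⟩ | i', h⟩
    · cases h
    · obtain rfl := Sum.inr.inj h
      rfl
  right_inv _ := rfl

theorem semiconj_fibreInlEquiv (u : U) :
    Semiconj (fibreInlEquiv (I := I) u) (SerreGraph.fibreInv generator_inv _) Bool.not := by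
  rintro ⟨⟨_, b⟩ | i, h⟩
  · rfl
  · cases h

theorem semiconj_fibreInrEquiv (i : I) :
    Semiconj (fibreInrEquiv (U := U) i) (SerreGraph.fibreInv generator_inv _) id :=
  fun _ => rfl

end MixedLetter

namespace SerreGraph

variable {G : SerreGraph.{u}}

/-- A deterministic labelling by the letters `S ∪ S⁻¹`, where `S = U ∪ I`. -/
abbrev MixedLabelling (G : SerreGraph.{u}) (U I : Type u) : Type u :=
  G.Labelling (MixedLetter.inv (U := U) (I := I))

theorem MixedLabelling.isWeakMulticycle_and_isRegular_colourClass {U I : Type u}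
    (L : G.MixedLabelling U I) (a : U ⊕ I) :
    (G.colourClass (L.colouring MixedLetter.generator_inv) a).IsWeakMulticycle ∧
      (G.colourClass (L.colouring MixedLetter.generator_inv) a).IsRegular := by
  rw [isWeakMulticycle_and_isRegular_iff]
  rcases a with u | i
  · exact Or.inl ⟨(L.restrict _ _).relabel _ (MixedLetter.semiconj_fibreInlEquiv u)⟩
  · exact Or.inr ⟨(L.restrict _ _).relabel _ (MixedLetter.semiconj_fibreInrEquiv i)⟩

theorem nonempty_mixedLabelling {U I : Type u} {c : G.UEdge → U ⊕ I}
    (hU : ∀ u, Nonempty (G.colourClass c (Sum.inl u)).CyclicOrientation)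
    (hI : ∀ i, Nonempty (G.colourClass c (Sum.inr i)).PerfectMatching) :
    Nonempty (G.MixedLabelling U I) := by
  refine ⟨Labelling.glue MixedLetter.generator_inv (c := c) ?_⟩
  rintro (u | i)
  · let φ := MixedLetter.fibreInlEquiv (I := I) u
    exact (hU u).some.relabel φ.symm
      ((MixedLetter.semiconj_fibreInlEquiv u).inverse_left φ.left_inv φ.right_inv)
  · let φ := MixedLetter.fibreInrEquiv (U := U) i
    exact (hI i).some.relabel φ.symm
      ((MixedLetter.semiconj_fibreInrEquiv i).inverse_left φ.left_inv φ.right_inv)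

theorem exists_colouring_iff_exists_mixedLabelling :
    (∃ (Ω : Type u) (c : G.UEdge → Ω), G.IsWeakMulticycleColouring c ∧ G.IsPartitionFriendly c) ↔
      ∃ U I : Type u, Nonempty (G.MixedLabelling U I) := by
  constructor
  · rintro ⟨Ω, c, hc, hr⟩
    classical
    let IsCyclic (a : Ω) : Prop := Nonempty (G.colourClass c a).CyclicOrientation
    have matching_of_not_isCyclic (a) (ha : ¬IsCyclic a) :
        Nonempty (G.colourClass c a).PerfectMatching :=
      (isWeakMulticycle_and_isRegular_iff.1 ⟨hc a, hr a⟩).resolve_left ha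
    let split : Ω ≃ {a // IsCyclic a} ⊕ {a // ¬IsCyclic a} := (Equiv.sumCompl IsCyclic).symm
    refine ⟨_, _, nonempty_mixedLabelling (c := split ∘ c) (fun u => ?_) fun i => ?_⟩
    · exact u.2.map fun L => L.comap (colourClassCompIso c split _)
    · exact (matching_of_not_isCyclic i.1 i.2).map fun L =>
        L.comap (colourClassCompIso c split _)
  · rintro ⟨U, I, ⟨L⟩⟩
    exact ⟨_, _, forall_and.1 L.isWeakMulticycle_and_isRegular_colourClass⟩

end SerreGraph

namespace PartitePresentation

variable (P : PartitePresentation.{u})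

theorem conj_mem_relSubgroup {x : P.X} {g : P.MF} (hg : g ∈ P.relSubgroup x) (k : P.MF) :
    k⁻¹ * g * k ∈ P.relSubgroup (P.act x k) := by
  have le_comap : P.relSubgroup x ≤
      (P.relSubgroup (P.act x k)).comap (MulAut.conj k⁻¹).toMonoidHom := by
    refine (Subgroup.closure_le _).2 ?_
    rintro _ ⟨w, r, hr, rfl⟩
    refine Subgroup.subset_closure ⟨k⁻¹ * w, r, ?_, ?_⟩
    · rwa [← P.act_mul, mul_inv_cancel_left]
    · simp [mul_assoc]
  simpa using le_comap hg

theorem vertexSetoid_mul_right {b : P.X} {g h : P.MF} (hgh : P.vertexSetoid b g h) (k : P.MF) :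
    P.vertexSetoid b (g * k) (h * k) := by
  obtain ⟨hact, hrel⟩ := hgh
  refine ⟨by rw [P.act_mul, P.act_mul, hact], ?_⟩
  rw [P.act_mul, mul_inv_rev, mul_assoc, ← mul_assoc g⁻¹, ← mul_assoc]
  exact P.conj_mem_relSubgroup hrel k

theorem source_mk (b : P.X) (e : P.MF × P.Letter) :
    (P.SpAt b).source (Quotient.mk (P.edgeSetoid b) e) = Quotient.mk (P.vertexSetoid b) e.1 :=
  congrArg (Quotient.mk (P.vertexSetoid b)) (P.tree_tau_inv e)

/-- The labelling of the partite Cayley graph by the colours of its directed edges. -/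
def labelling (b : P.X) : (P.SpAt b).MixedLabelling P.U P.I where
  label := Quotient.lift (s := P.edgeSetoid b) Prod.snd fun _ _ h => h.1
  label_inv := by
    rintro ⟨g, ⟨u, b⟩ | i⟩ <;> rfl
  bijective := by
    constructor
    · rintro ⟨g, s⟩ ⟨h, t⟩ heq
      obtain ⟨hsource, rfl : s = t⟩ := Prod.mk.inj heq
      have hgh : P.vertexSetoid b g h :=
        Quotient.exact ((P.source_mk b (g, s)).symm.trans (hsource.trans (P.source_mk b (h, s))))
      exact Quotient.sound (s := P.edgeSetoid b) ⟨rfl, P.vertexSetoid_mul_right hgh _, hgh⟩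
    · rintro ⟨⟨g⟩, s⟩
      exact ⟨Quotient.mk (P.edgeSetoid b) (g, s), Prod.ext (P.source_mk b (g, s)) rfl⟩

theorem next_labelling_mk (b : P.X) (s : P.Letter) (g : P.MF) :
    (P.labelling b).next s (Quotient.mk (P.vertexSetoid b) g) =
      Quotient.mk (P.vertexSetoid b) (g * Letter.val P s) := by
  rw [← P.source_mk b (g, s)]
  exact (P.labelling b).next_label_source (Quotient.mk (P.edgeSetoid b) (g, s))

theorem vertexSetoid_iff_of_stabilizer_le
    (hR : ∀ x g, P.act x g = x → g ∈ P.relSubgroup x) {b : P.X} {g h : P.MF} :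
    P.vertexSetoid b g h ↔ P.act b g = P.act b h := by
  refine ⟨And.left, fun hgh => ⟨hgh, hR _ _ ?_⟩⟩
  rw [← P.act_mul, mul_inv_cancel_left, hgh]

/-- If the relators generate the stabilisers, then the partite Cayley graph has one vertex in each
class. -/
noncomputable def vertexEquiv (hR : ∀ x g, P.act x g = x → g ∈ P.relSubgroup x) (b : P.X) :
    (P.SpAt b).V ≃ P.X :=
  Equiv.ofBijective
    (Quotient.lift (s := P.vertexSetoid b) (P.act b) fun _ _ h => h.1) (by
      constructor
      · rintro ⟨g⟩ ⟨h⟩ hgh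
        exact Quotient.sound (s := P.vertexSetoid b)
          ((P.vertexSetoid_iff_of_stabilizer_le hR).2 hgh)
      · intro y
        obtain ⟨g, hg⟩ := P.transitive b y
        exact ⟨Quotient.mk (P.vertexSetoid b) g, hg⟩)

end PartitePresentation

namespace SerreGraph

variable {G : SerreGraph.{u}}

namespace MixedLabelling

variable {U I : Type u} (L : G.MixedLabelling U I)

/-- The permutation of the vertices that follows the edges labelled by a generator. -/
noncomputable def genPerm : U ⊕ I → Equiv.Perm G.V
  | Sum.inl u => L.perm (Sum.inl (u, true))
  | Sum.inr i => L.perm (Sum.inr i)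

theorem genPerm_invol (i : I) (x : G.V) : L.genPerm (Sum.inr i) (L.genPerm (Sum.inr i) x) = x :=
  L.leftInverse_next (Sum.inr i) x

theorem mixedAction_val (s : MixedLetter U I) (x : G.V) :
    (mixedAction L.genPerm L.genPerm_invol s.val).unop x = L.next s x := by
  rcases s with ⟨u, _ | _⟩ | i
  all_goals
    simp only [MixedLetter.val, map_inv, mixedAction, PresentedGroup.toGroup.of]
    rfl

theorem exists_mixedAction_eq (hG : G.Connected) (x y : G.V) :
    ∃ g, (mixedAction L.genPerm L.genPerm_invol g).unop x = y := by
  induction hG.2 x y with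
  | refl => exact ⟨1, by simp⟩
  | tail _ step ih =>
    obtain ⟨g, rfl⟩ := ih
    obtain ⟨e, hsource, rfl⟩ := step
    refine ⟨g * (L.label e).val, ?_⟩
    rw [map_mul, MulOpposite.unop_mul, Equiv.Perm.mul_apply, mixedAction_val, ← hsource]
    exact L.next_label_source e

/-- The partite presentation with one class for each vertex, in which every element of the
stabiliser of a class is a relator. -/
noncomputable def presentation (hG : G.Connected) : PartitePresentation.{u} where
  X := G.V
  U := U
  I := I
  nonempty := hG.1
  φ := L.genPerm
  φ_invol := L.genPerm_invol
  φ_fixfree _ := L.next_ne_self rfl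
  transitive := L.exists_mixedAction_eq hG
  R x := {g | (mixedAction L.genPerm L.genPerm_invol g).unop x = x}
  R_stab _ _ hr := hr

theorem mem_relSubgroup_presentation (hG : G.Connected) (x : (L.presentation hG).X)
    (g : (L.presentation hG).MF) (hg : (L.presentation hG).act x g = x) :
    g ∈ (L.presentation hG).relSubgroup x := by
  refine Subgroup.subset_closure ⟨1, g, ?_, by simp⟩
  rw [PartitePresentation.act_one]
  exact hg

theorem act_presentation_val (hG : G.Connected) (x : G.V) (s : MixedLetter U I) :
    (L.presentation hG).act x (PartitePresentation.Letter.val (L.presentation hG) s) =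
      L.next s x := by
  rw [← L.mixedAction_val]
  rcases s with ⟨u, _ | _⟩ | i <;> rfl

theorem nonempty_iso_Sp_presentation (hG : G.Connected) :
    Nonempty (Iso G (L.presentation hG).Sp) := by
  let P := L.presentation hG
  let b := Classical.choice P.nonempty
  let f : (P.SpAt b).V ≃ P.X := P.vertexEquiv (L.mem_relSubgroup_presentation hG) b
  refine ⟨((P.labelling b).isoOfSemiconj L f ?_).symm⟩
  rintro s ⟨g⟩
  have act_mul_val : P.act b (g * PartitePresentation.Letter.val P s) = L.next s (P.act b g) :=
    (P.act_mul _ _ _).trans (L.act_presentation_val hG _ s)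
  exact (congrArg f (P.next_labelling_mk b s g)).trans act_mul_val

end MixedLabelling

theorem exists_mixedLabelling_iff_exists_iso_Sp (hG : G.Connected) :
    (∃ U I : Type u, Nonempty (G.MixedLabelling U I)) ↔
      ∃ P : PartitePresentation.{u}, Nonempty (Iso G P.Sp) := by
  constructor
  · rintro ⟨U, I, ⟨L⟩⟩
    exact ⟨L.presentation hG, L.nonempty_iso_Sp_presentation hG⟩
  · rintro ⟨P, ⟨f⟩⟩
    exact ⟨P.U, P.I, ⟨(P.labelling _).comap f⟩⟩

end SerreGraph

theorem mainTheorem4 (G : SerreGraph.{u}) (hG : G.Connected) :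
    (∃ (Ω : Type u) (c : G.UEdge → Ω),
        G.IsWeakMulticycleColouring c ∧ G.IsPartitionFriendly c) ↔
      ∃ P : PartitePresentation.{u}, Nonempty (SerreGraph.Iso G P.Sp) :=
  SerreGraph.exists_colouring_iff_exists_mixedLabelling.trans
    (SerreGraph.exists_mixedLabelling_iff_exists_iso_Sp hG)
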